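/- Let $k,d\in\mathbb N$, let $\Omega=\{1,\dots,k\}^{\mathbb N}$ carry the product $\sigma$-algebra, let $\sigma:\Omega\to\Omega$, $(\sigma\omega)_i=\omega_{i+1}$, be the shift, and let $\mathbb P$ be a $\sigma$-invariant probability measure on $\Omega$ under which the coordinates form a Markov chain and which gives positive mass to every nonempty cylinder set (a one-sided Markovian full shift over $k$ symbols). Let $\varphi$ be a linear random dynamical system on $\mathbb R^d$ over $\sigma$, i.e. a family of real $d\times d$ matrices $\varphi(n,\omega)$ $(n\ge 0,\ \omega\in\Omega)$, with $(n,\omega,x)\mapsto\varphi(n,\omega)x$ measurable, $\varphi(0,\omega)=I$ and $\varphi(m+n,\omega)=\varphi(n,\sigma^m\omega)\varphi(m,\omega)$. Assume: - $\varphi(1,\omega)$ depends only on the coordinate $\omega_0$; - $\varphi$ is spatially invertible: every $\varphi(1,\omega)$ is an invertible matrix; - $\varphi$ is strongly irreducible: there is no finite nonempty family of linear subspaces $V_1,\dots,V_r$ of $\mathbb R^d$, each different from $\{0\}$ and from $\mathbb R^d$, such that $A(V_1\cup\dots\cup V_r)=V_1\cup\dots\cup V_r$ for every $A\in\{\varphi(n,\omega):n\ge0,\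 \omega\in\Omega\}$. Let $\psi(n,\omega)[x]=[\varphi(n,\omega)x]$ be the induced random dynamical system on the projective space $\mathbb{RP}^{d-1}$ (with its Borel $\sigma$-algebra), and let $\nu$ be any invariant measure for $\psi$: a probability measure on $\Omega\times\mathbb{RP}^{d-1}$ whose marginal on $\Omega$ is $\mathbb P$ and which is invariant under the skew product $(\omega,p)\mapsto(\sigma\omega,\psi(1,\omega)p)$. Then $\nu$ is proper: for every linear hyperplane $H$ of $\mathbb R^d$ (a subspace of dimension $d-1$), $$\nu\bigl(\Omega\times\overline H\bigr)=0,\qquad \overline H=\{[x]: x\in H\setminus\{0\}\}.$$ -/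

import Mathlib

open MeasureTheory ProbabilityTheory Set
open scoped LinearAlgebra.Projectivization

noncomputable section

namespace MarkovRDS

/-! ### One-sided shift spaces over `k` symbols -/

/-- The one-sided sequence space over `k` symbols; its sigma-algebra is the product one, that is,
the one generated by the cylinder sets. -/
abbrev Omega (k : ℕ) : Type := ℕ → Fin k

/-- The shift map `(σ ω)_i = ω_{i+1}`. -/
def shift {k : ℕ} (ω : Omega k) : Omega k := fun i => ω (i + 1)

/-- The coordinate process is a Markov chain under `P`:
`P(ω_{n+1} = b | ω_0 = a_0, …, ω_n = a_n) = P(ω_{n+1} = b | ω_n = a_n)`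
whenever the conditioning event on the left has positive probability. -/
def IsMarkovian {k : ℕ} (P : Measure (Omega k)) : Prop :=
  ∀ (n : ℕ) (a : ℕ → Fin k) (b : Fin k), P {ω | ∀ i ≤ n, ω i = a i} ≠ 0 →
    (P[|{ω | ∀ i ≤ n, ω i = a i}]) {ω | ω (n + 1) = b} =
      (P[|{ω | ω n = a n}]) {ω | ω (n + 1) = b}

/-- Every cylinder set has positive probability. -/
def IsFull {k : ℕ} (P : Measure (Omega k)) : Prop :=
  ∀ (s : Finset ℕ) (a : ℕ → Fin k), 0 < P {ω | ∀ i ∈ s, ω i = a i}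

/-- `P` makes the sequence space a one-sided Markovian full shift over `k` symbols. -/
structure IsMarkovianFullShift {k : ℕ} (P : Measure (Omega k)) : Prop where
  isProbabilityMeasure : IsProbabilityMeasure P
  invariant : MeasurePreserving shift P P
  markovian : IsMarkovian P
  full : IsFull P

/-! ### Random dynamical systems -/

/-- A (one-sided, discrete-time) random dynamical system acting on `X`. -/
structure RDS (k : ℕ) (X : Type*) [MeasurableSpace X] where
  toFun : ℕ → Omega k → X → X
  measurable_toFun : Measurable fun p : ℕ × Omega k × X => toFun p.1 p.2.1 p.2.2
  zero : ∀ ω, toFun 0 ω = id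
  add : ∀ m n ω, toFun (m + n) ω = toFun n (shift^[m] ω) ∘ toFun m ω

/-- A linear random dynamical system acting on `ℝ^d`, given by its matrices. -/
structure LRDS (k d : ℕ) where
  mat : ℕ → Omega k → Matrix (Fin d) (Fin d) ℝ
  measurable_mat : Measurable
    fun p : ℕ × Omega k × (Fin d → ℝ) => (mat p.1 p.2.1).mulVec p.2.2
  zero : ∀ ω, mat 0 ω = 1
  add : ∀ m n ω, mat (m + n) ω = mat n (shift^[m] ω) * mat m ω

/-- Every `φ(1, ω)` is invertible. -/
def LRDS.SpatiallyInvertible {k d : ℕ} (φ : LRDS k d) : Prop :=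
  ∀ ω, IsUnit (φ.mat 1 ω)

/-- `φ(1, ω)` depends only on the coordinate `ω_0`. -/
def LRDS.DependsOnFirst {k d : ℕ} (φ : LRDS k d) : Prop :=
  ∀ ω ω' : Omega k, ω 0 = ω' 0 → φ.mat 1 ω = φ.mat 1 ω'

/-- The semigroup `{φ(n, ω) : n ≥ 0, ω ∈ Ω}`. -/
def LRDS.semigroup {k d : ℕ} (φ : LRDS k d) : Set (Matrix (Fin d) (Fin d) ℝ) :=
  {A | ∃ n ω, A = φ.mat n ω}

/-- No finite nonempty family of nonzero proper linear subspaces has its union mapped onto itself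
by every element of the semigroup. -/
def LRDS.StronglyIrreducible {k d : ℕ} (φ : LRDS k d) : Prop :=
  ¬ ∃ s : Finset (Submodule ℝ (Fin d → ℝ)), s.Nonempty ∧ (∀ V ∈ s, V ≠ ⊥ ∧ V ≠ ⊤) ∧
    ∀ A ∈ φ.semigroup,
      (fun x => A.mulVec x) '' (⋃ V ∈ s, (V : Set (Fin d → ℝ))) =
        ⋃ V ∈ s, (V : Set (Fin d → ℝ))

/-! ### Real projective space -/

/-- The projective space of `ℝ^d`. -/
abbrev Proj (d : ℕ) : Type := ℙ ℝ (Fin d → ℝ)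

/-- The quotient topology from `ℝ^d \ {0}`. -/
instance instTopologicalSpaceProj (d : ℕ) : TopologicalSpace (Proj d) :=
  TopologicalSpace.coinduced
    (fun v : {v : Fin d → ℝ // v ≠ 0} => Projectivization.mk ℝ v.1 v.2) inferInstance

instance instMeasurableSpaceProj (d : ℕ) : MeasurableSpace (Proj d) := borel _

instance instBorelSpaceProj (d : ℕ) : BorelSpace (Proj d) := ⟨rfl⟩

/-- The set `{[x] : x ∈ W, x ≠ 0}` of projective points lying on the subspace `W`. -/
def projSubspace {d : ℕ} (W : Submodule ℝ (Fin d → ℝ)) : Set (Proj d) :=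
  {p | p.submodule ≤ W}

/-- The projection `ℝ^d \ {0} → ℙ`. -/
def projMk (d : ℕ) (v : {v : Fin d → ℝ // v ≠ 0}) : Proj d := Projectivization.mk ℝ v.1 v.2

theorem isOpenQuotientMap_projMk (d : ℕ) : IsOpenQuotientMap (projMk d) := by
  refine ⟨?_, continuous_coinduced_rng, ?_⟩
  · intro p
    exact ⟨⟨p.rep, p.rep_nonzero⟩, p.mk_rep⟩
  · intro U hU
    change IsOpen (projMk d ⁻¹' (projMk d '' U))
    have key : projMk d ⁻¹' (projMk d '' U) =
        ⋃ a : ℝˣ, (fun v : {v : Fin d → ℝ // v ≠ 0} =>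
          (⟨a • v.1, (smul_ne_zero_iff_ne a).2 v.2⟩ : {v : Fin d → ℝ // v ≠ 0})) ⁻¹' U := by
      ext v
      simp only [mem_preimage, mem_image, mem_iUnion]
      constructor
      · rintro ⟨u, hu, huv⟩
        obtain ⟨a, ha⟩ := (Projectivization.mk_eq_mk_iff ℝ u.1 v.1 u.2 v.2).1 huv
        refine ⟨a, ?_⟩
        have h : (⟨a • v.1, (smul_ne_zero_iff_ne a).2 v.2⟩ :
          {v : Fin d → ℝ // v ≠ 0}) = u := Subtype.ext ha
        rw [h]
        exact hu
      · rintro ⟨a, ha⟩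
        refine ⟨_, ha, ?_⟩
        exact (Projectivization.mk_eq_mk_iff ℝ _ _ _ _).2 ⟨a, rfl⟩
    rw [key]
    refine isOpen_iUnion fun a => hU.preimage ?_
    exact Continuous.subtype_mk (continuous_subtype_val.const_smul a) _

instance instSecondCountableProj (d : ℕ) : SecondCountableTopology (Proj d) :=
  (isOpenQuotientMap_projMk d).isQuotientMap.secondCountableTopology
    (isOpenQuotientMap_projMk d).isOpenMap

/-! ### The induced system on projective space -/

theorem LRDS.isUnit_mat {k d : ℕ} (φ : LRDS k d) (h : φ.SpatiallyInvertible)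
    (n : ℕ) (ω : Omega k) : IsUnit (φ.mat n ω) := by
  induction n with
  | zero => rw [φ.zero]; exact isUnit_one
  | succ n ih => rw [φ.add]; exact (h _).mul ih

theorem LRDS.injective_mat {k d : ℕ} (φ : LRDS k d) (h : φ.SpatiallyInvertible)
    (n : ℕ) (ω : Omega k) : Function.Injective (φ.mat n ω).mulVecLin :=
  Matrix.mulVec_injective_of_isUnit (φ.isUnit_mat h n ω)

theorem continuous_projAction (d : ℕ) :
    Continuous fun q : {A : Matrix (Fin d) (Fin d) ℝ // Function.Injective A.mulVecLin} × Proj d =>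
      (Projectivization.map q.1.1.mulVecLin q.1.2 q.2 : Proj d) := by
  have hq := (IsOpenQuotientMap.id
    (X := {A : Matrix (Fin d) (Fin d) ℝ // Function.Injective A.mulVecLin})).prodMap
    (isOpenQuotientMap_projMk d)
  rw [hq.isQuotientMap.continuous_iff]
  have h2 : Continuous fun q : {A : Matrix (Fin d) (Fin d) ℝ // Function.Injective A.mulVecLin} ×
      {v : Fin d → ℝ // v ≠ 0} =>
      projMk d ⟨q.1.1.mulVecLin q.2.1, by
        intro h0
        exact q.2.2 (q.1.2 (by rw [h0, map_zero]))⟩ := by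
    refine (isOpenQuotientMap_projMk d).continuous.comp (Continuous.subtype_mk ?_ _)
    simp only [Matrix.mulVecLin_apply]
    exact (continuous_subtype_val.comp continuous_fst).matrix_mulVec
      (continuous_subtype_val.comp continuous_snd)
  exact h2

theorem LRDS.measurable_mat_apply {k d : ℕ} (φ : LRDS k d) (i j : Fin d) :
    Measurable fun p : ℕ × Omega k => φ.mat p.1 p.2 i j := by
  have h := φ.measurable_mat.comp
    (show Measurable fun p : ℕ × Omega k => (p.1, p.2, (Pi.single j 1 : Fin d → ℝ)) by fun_prop)
  have h2 := (measurable_pi_apply i).comp h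
  simpa [Function.comp_def] using h2

theorem LRDS.measurable_induced {k d : ℕ} (φ : LRDS k d) (h : φ.SpatiallyInvertible) :
    Measurable fun p : ℕ × Omega k × Proj d =>
      (Projectivization.map (φ.mat p.1 p.2.1).mulVecLin (φ.injective_mat h p.1 p.2.1) p.2.2 :
        Proj d) := by
  let _ : MeasurableSpace (Matrix (Fin d) (Fin d) ℝ) :=
    inferInstanceAs (MeasurableSpace (Fin d → Fin d → ℝ))
  have : BorelSpace (Matrix (Fin d) (Fin d) ℝ) :=
    inferInstanceAs (BorelSpace (Fin d → Fin d → ℝ))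
  have : SecondCountableTopology (Matrix (Fin d) (Fin d) ℝ) :=
    inferInstanceAs (SecondCountableTopology (Fin d → Fin d → ℝ))
  have hm : Measurable fun p : ℕ × Omega k => φ.mat p.1 p.2 :=
    measurable_pi_lambda _ fun i => measurable_pi_lambda _ fun j => φ.measurable_mat_apply i j
  have hm2 : Measurable fun p : ℕ × Omega k × Proj d =>
      ((⟨φ.mat p.1 p.2.1, φ.injective_mat h p.1 p.2.1⟩ :
        {A : Matrix (Fin d) (Fin d) ℝ // Function.Injective A.mulVecLin}), p.2.2) := by
    refine Measurable.prodMk (Measurable.subtype_mk ?_) (by fun_prop)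
    exact hm.comp (by fun_prop : Measurable fun p : ℕ × Omega k × Proj d => (p.1, p.2.1))
  exact (continuous_projAction d).measurable.comp hm2

/-- The normalized random dynamical system on projective space, `[x] ↦ [φ(n, ω) x]`. -/
def LRDS.induced {k d : ℕ} (φ : LRDS k d) (h : φ.SpatiallyInvertible) : RDS k (Proj d) where
  toFun n ω := Projectivization.map (φ.mat n ω).mulVecLin (φ.injective_mat h n ω)
  measurable_toFun := φ.measurable_induced h
  zero ω := by
    funext p
    induction p using Projectivization.ind with
    | h v hv => simp [Projectivization.map_mk, φ.zero]
  add m n ω := by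
    funext p
    induction p using Projectivization.ind with
    | h v hv => simp [Projectivization.map_mk, φ.add]

/-! ### Invariant and proper measures -/

/-- The skew product `(ω, x) ↦ (σ ω, φ(1, ω) x)`. -/
def RDS.skewProduct {k : ℕ} {X : Type*} [MeasurableSpace X] (ψ : RDS k X)
    (p : Omega k × X) : Omega k × X :=
  (shift p.1, ψ.toFun 1 p.1 p.2)

/-- `ν` is an invariant measure for the RDS `ψ` over the shift with measure `P`. -/
structure RDS.IsInvariantMeasure {k : ℕ} {X : Type*} [MeasurableSpace X] (ψ : RDS k X)
    (P : Measure (Omega k)) (ν : Measure (Omega k × X)) : Prop where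
  isProbabilityMeasure : IsProbabilityMeasure ν
  map_skewProduct : ν.map ψ.skewProduct = ν
  map_fst : ν.map Prod.fst = P

/-- `ν(Ω × H̄) = 0` for every linear hyperplane `H` of `ℝ^d`. For a factorised measure
`ν(dω, dx) = ν_ω(dx) P(dω)` the left-hand side is `∫ ν_ω(H̄) P(dω)`. -/
def IsProper {k d : ℕ} (ν : Measure (Omega k × Proj d)) : Prop :=
  ∀ H : Submodule ℝ (Fin d → ℝ), Module.finrank ℝ H + 1 = d →
    ν (univ ×ˢ projSubspace H) = 0

end MarkovRDS

end

namespace MarkovRDS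

open scoped ENNReal

variable {k : ℕ}

/-! ### Cylinders and the Markov property -/

/-! If some hyperplane is charged, let `l` be the least dimension of a subspace `V` with `ν(Ω × ℙV)
> 0`; then `0 < l < d`. Distinct `l`-dimensional subspaces meet in lower dimension, hence in null
sets, so the measures `n_V(B) = ν(B × ℙV)` have summable masses. They are dominated by `P`, say with
densities `f_V ≤ 1`, and invariance of `ν` relates `n_W` to the `n_V` with `T_j V = W`, where `T_j`
is the action of the symbol `j` on subspaces.

This averaged relation is in fact pointwise (`ae_eq_comp_shift_of_transfer_invariant`): expanding
squares, the sum over `j` and `V` of `∫_[j] (f_V - f_{T_j V} ∘ σ)²` is `Q + Q - 2Q = 0`, where `Q =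
∑ ∫ f_V²`. Integrating over `[j]` and using the Markov property, `h_j(V) = n_V[j] / P[j]` is
harmonic for the forward transition probabilities, all of them positive. By the maximum principle
(`exists_finset_mapsTo_of_harmonic`) the subspaces at which every `h_i` is maximal form a finite
nonempty family stable under all `T_j`, which contradicts strong irreducibility. -/

/-- The set of sequences starting with the symbol `j`. -/
def firstSymbol (j : Fin k) : Set (Omega k) := {ω | ω 0 = j}

/-- The cylinder of sequences agreeing with `a` up to time `n`. -/
def initialCylinder (n : ℕ) (a : Omega k) : Set (Omega k) := {ω | ∀ i ≤ n, ω i = a i}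

theorem measurable_shift : Measurable (shift : Omega k → Omega k) :=
  measurable_pi_lambda _ fun i => measurable_pi_apply (i + 1)

theorem measurableSet_symbol (n : ℕ) (j : Fin k) : MeasurableSet {ω : Omega k | ω n = j} :=
  measurableSet_eq_fun (measurable_pi_apply n) measurable_const

theorem measurableSet_firstSymbol (j : Fin k) : MeasurableSet (firstSymbol j) :=
  measurableSet_symbol 0 j

theorem measurableSet_initialCylinder (n : ℕ) (a : Omega k) :
    MeasurableSet (initialCylinder n a) := by
  have : initialCylinder n a = ⋂ i ∈ Iic n, {ω : Omega k | ω i = a i} := by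
    ext ω; simp [initialCylinder]
  rw [this]
  exact MeasurableSet.biInter (to_countable _) fun i _ => measurableSet_symbol i _

theorem initialCylinder_eq {n : ℕ} {a b : Omega k} (h : b ∈ initialCylinder n a) :
    initialCylinder n a = initialCylinder n b := by
  ext ω
  exact ⟨fun hω i hi => (hω i hi).trans (h i hi).symm, fun hω i hi => (hω i hi).trans (h i hi)⟩

theorem initialCylinder_anti {m n : ℕ} (h : m ≤ n) (a : Omega k) :
    initialCylinder n a ⊆ initialCylinder m a :=
  fun _ hω i hi => hω i (hi.trans h)

theorem isPiSystem_initialCylinder :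
    IsPiSystem {s : Set (Omega k) | ∃ n a, s = initialCylinder n a} := by
  rintro _ ⟨n, a, rfl⟩ _ ⟨m, b, rfl⟩ ⟨c, hca, hcb⟩
  refine ⟨max n m, c, ?_⟩
  rw [initialCylinder_eq hca, initialCylinder_eq hcb]
  apply Subset.antisymm
  · rintro ω ⟨h1, h2⟩ i hi
    rcases le_max_iff.1 hi with h | h
    exacts [h1 i h, h2 i h]
  · exact subset_inter (initialCylinder_anti (le_max_left _ _) c)
      (initialCylinder_anti (le_max_right _ _) c)

theorem generateFrom_initialCylinder :
    (inferInstance : MeasurableSpace (Omega k)) =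
      MeasurableSpace.generateFrom {s | ∃ n a, s = initialCylinder n a} := by
  apply le_antisymm
  · refine iSup_le fun n => ?_
    rw [MeasurableSpace.comap_le_iff_le_map]
    intro s _
    change MeasurableSet[MeasurableSpace.generateFrom {s | ∃ n a, s = initialCylinder n a}]
      ((fun ω : Omega k => ω n) ⁻¹' s)
    -- A finite union over words `c` of length `n + 1`; `Fin.ofNat` extends a word periodically to a
    -- sequence, of which only the entries up to `n` matter.
    have : (fun ω : Omega k => ω n) ⁻¹' s =
        ⋃ c ∈ {c : Fin (n + 1) → Fin k | c (Fin.ofNat (n + 1) n) ∈ s},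
          initialCylinder n fun i => c (Fin.ofNat (n + 1) i) := by
      ext ω
      simp only [mem_preimage, mem_iUnion, mem_ofPred_eq, initialCylinder]
      constructor
      · intro h
        have hm : ∀ i ≤ n, i % (n + 1) = i := fun i hi => Nat.mod_eq_of_lt (by lia)
        refine ⟨fun i => ω i, ?_, fun i hi => ?_⟩
        · simpa [Fin.ofNat, hm n le_rfl] using h
        · simp [Fin.ofNat, hm i hi]
      · rintro ⟨c, hc, h⟩
        rw [h n le_rfl]
        exact hc
    rw [this]
    exact MeasurableSet.biUnion (to_countable _) fun c _ =>
      MeasurableSpace.measurableSet_generateFrom ⟨n, _, rfl⟩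
  · refine MeasurableSpace.generateFrom_le ?_
    rintro _ ⟨n, a, rfl⟩
    exact measurableSet_initialCylinder n a

theorem ext_of_initialCylinder {μ ν : Measure (Omega k)} [IsFiniteMeasure μ]
    (h : ∀ n a, μ (initialCylinder n a) = ν (initialCylinder n a)) : μ = ν := by
  have huniv : (univ : Set (Omega k)) = ⋃ j : Fin k, initialCylinder 0 fun _ => j := by
    ext ω; simp [initialCylinder]
  have hd : Pairwise (Function.onFun Disjoint
      fun j : Fin k => initialCylinder 0 fun _ : ℕ => j) := by
    intro i j hij
    refine Set.disjoint_left.2 fun ω h1 h2 => hij ?_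
    exact (h1 0 le_rfl).symm.trans (h2 0 le_rfl)
  refine ext_of_generate_finite _ generateFrom_initialCylinder isPiSystem_initialCylinder ?_ ?_
  · rintro _ ⟨n, a, rfl⟩
    exact h n a
  · rw [huniv, measure_iUnion hd fun j => measurableSet_initialCylinder _ _,
      measure_iUnion hd fun j => measurableSet_initialCylinder _ _]
    exact tsum_congr fun j => h _ _

theorem lintegral_eq_sum_firstSymbol (μ : Measure (Omega k)) (g : Omega k → ℝ≥0∞) :
    ∫⁻ ω, g ω ∂μ = ∑ j, ∫⁻ ω in firstSymbol j, g ω ∂μ := by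
  have huniv : (univ : Set (Omega k)) = ⋃ j : Fin k, firstSymbol j := by
    ext ω; simp [firstSymbol]
  have hd : Pairwise (Function.onFun Disjoint fun j : Fin k => firstSymbol j) := by
    intro i j hij
    exact Set.disjoint_left.2 fun ω h1 h2 => hij (Eq.trans (Eq.symm h1) h2)
  rw [← setLIntegral_univ, huniv, lintegral_iUnion measurableSet_firstSymbol hd, tsum_fintype]

/-- The reversed transition weights `P(ω₀ = j, ω₁ = i) / P(ω₀ = i)`. -/
noncomputable def backwardWeight (P : Measure (Omega k)) (j i : Fin k) : ℝ≥0∞ :=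
  P {ω | ω 0 = j ∧ ω 1 = i} / P (firstSymbol i)

namespace IsMarkovianFullShift

variable {P : Measure (Omega k)}

theorem firstSymbol_pos (hP : IsMarkovianFullShift P) (j : Fin k) : 0 < P (firstSymbol j) := by
  simpa [firstSymbol] using hP.full {0} fun _ => j

theorem initialCylinder_pos (hP : IsMarkovianFullShift P) (n : ℕ) (a : Omega k) :
    0 < P (initialCylinder n a) := by
  have h := hP.full (Finset.Iic n) a
  simpa [initialCylinder] using h

theorem backwardWeight_pos (hP : IsMarkovianFullShift P) (j i : Fin k) :
    0 < backwardWeight P j i := by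
  have := hP.isProbabilityMeasure
  refine ENNReal.div_pos ?_ (measure_ne_top _ _)
  have h := hP.full {0, 1} fun n => if n = 0 then j else i
  simpa using h.ne'

theorem backwardWeight_ne_top (hP : IsMarkovianFullShift P) (j i : Fin k) :
    backwardWeight P j i ≠ ∞ := by
  have := hP.isProbabilityMeasure
  exact ENNReal.div_ne_top (measure_ne_top _ _) (hP.firstSymbol_pos i).ne'

theorem measure_symbol (hP : IsMarkovianFullShift P) (n : ℕ) (j : Fin k) :
    P {ω | ω n = j} = P (firstSymbol j) := by
  induction n with
  | zero => rfl
  | succ n ih =>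
    rw [← ih, ← hP.invariant.measure_preimage (measurableSet_symbol n j).nullMeasurableSet]
    rfl

theorem measure_symbol_pair (hP : IsMarkovianFullShift P) (n : ℕ) (j i : Fin k) :
    P {ω | ω n = j ∧ ω (n + 1) = i} = P {ω | ω 0 = j ∧ ω 1 = i} := by
  induction n with
  | zero => rfl
  | succ n ih =>
    have hm : MeasurableSet {ω : Omega k | ω n = j ∧ ω (n + 1) = i} :=
      (measurableSet_symbol n j).inter (measurableSet_symbol (n + 1) i)
    rw [← ih, ← hP.invariant.measure_preimage hm.nullMeasurableSet]
    rfl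

theorem measure_initialCylinder_succ (hP : IsMarkovianFullShift P) (n : ℕ) (a : Omega k) :
    P (initialCylinder (n + 1) a) = P (initialCylinder n a) *
      ((P (firstSymbol (a n)))⁻¹ * P {ω | ω 0 = a n ∧ ω 1 = a (n + 1)}) := by
  have := hP.isProbabilityMeasure
  have h0 := (hP.initialCylinder_pos n a).ne'
  have h := hP.markovian n a (a (n + 1)) h0
  change (P[|initialCylinder n a]) _ = _ at h
  rw [cond_apply (measurableSet_initialCylinder n a), cond_apply (measurableSet_symbol n (a n)),
    hP.measure_symbol] at h
  have e1 : initialCylinder n a ∩ {ω | ω (n + 1) = a (n + 1)} = initialCylinder (n + 1) a := by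
    ext ω
    constructor
    · rintro ⟨h1, h2⟩ i hi
      rcases Nat.le_succ_iff.1 hi with h | rfl
      exacts [h1 i h, h2]
    · exact fun h => ⟨fun i hi => h i (by lia), h _ le_rfl⟩
  have e2 : {ω : Omega k | ω n = a n} ∩ {ω | ω (n + 1) = a (n + 1)} =
      {ω | ω n = a n ∧ ω (n + 1) = a (n + 1)} := rfl
  rw [e1, e2, hP.measure_symbol_pair] at h
  rw [← h, ← mul_assoc, ENNReal.mul_inv_cancel h0 (measure_ne_top _ _), one_mul]

/-- Lengthening a cylinder by a last symbol multiplies both sides by the same transition factor, so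
everything reduces to `n = 0`, where the weight is right by definition. -/
theorem measure_firstSymbol_inter_preimage (hP : IsMarkovianFullShift P) (j : Fin k) (n : ℕ)
    (a : Omega k) : P (firstSymbol j ∩ shift ⁻¹' initialCylinder n a) =
      backwardWeight P j (a 0) * P (initialCylinder n a) := by
  have := hP.isProbabilityMeasure
  -- `Nat.casesOn i j a` is the sequence `a` with `j` put in front.
  have key : ∀ n, firstSymbol j ∩ shift ⁻¹' initialCylinder n a =
      initialCylinder (n + 1) fun i => Nat.casesOn i j a := by
    intro n
    ext ω
    constructor
    · rintro ⟨h1, h2⟩ i hi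
      cases i with
      | zero => exact h1
      | succ i => exact h2 i (by lia)
    · exact fun h => ⟨h 0 (by lia), fun i hi => h (i + 1) (by lia)⟩
  induction n with
  | zero =>
    have e1 : firstSymbol j ∩ shift ⁻¹' initialCylinder 0 a = {ω | ω 0 = j ∧ ω 1 = a 0} := by
      ext ω; simp [firstSymbol, initialCylinder, shift]
    have e2 : initialCylinder 0 a = firstSymbol (a 0) := by
      ext ω; simp [firstSymbol, initialCylinder]
    rw [e1, e2, backwardWeight,
      ENNReal.div_mul_cancel (hP.firstSymbol_pos _).ne' (measure_ne_top _ _)]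
  | succ n ih =>
    rw [key, hP.measure_initialCylinder_succ, ← key, ih, hP.measure_initialCylinder_succ n a,
      mul_assoc]

/-- This is the form in which the Markov property enters later: the image of `P` on `[j]` has a
density with respect to `P` that is constant on each `[i]`. -/
theorem map_shift_restrict_firstSymbol (hP : IsMarkovianFullShift P) (j : Fin k) :
    (P.restrict (firstSymbol j)).map shift =
      ∑ i, backwardWeight P j i • P.restrict (firstSymbol i) := by
  have := hP.isProbabilityMeasure
  refine ext_of_initialCylinder fun n a => ?_
  have hm := measurableSet_initialCylinder n a
  rw [Measure.map_apply measurable_shift hm, Measure.restrict_apply (measurable_shift hm),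
    inter_comm, hP.measure_firstSymbol_inter_preimage, Measure.finsetSum_apply,
    Finset.sum_eq_single (a 0)]
  · rw [Measure.smul_apply, Measure.restrict_apply hm, smul_eq_mul]
    congr 2
    exact (inter_eq_left.2 fun ω (h : ω ∈ initialCylinder n a) => h 0 (by lia)).symm
  · intro i _ hi
    rw [Measure.smul_apply, Measure.restrict_apply hm]
    have : initialCylinder n a ∩ firstSymbol i = ∅ := by
      ext ω
      simp only [mem_inter_iff, mem_empty_iff_false, iff_false, not_and]
      exact fun h h' => hi (Eq.trans (Eq.symm h') (h 0 (by lia)))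
    simp [this]
  · simp

theorem setLIntegral_comp_shift (hP : IsMarkovianFullShift P) (j : Fin k) {g : Omega k → ℝ≥0∞}
    (hg : Measurable g) : ∫⁻ ω in firstSymbol j, g (shift ω) ∂P =
      ∑ i, backwardWeight P j i * ∫⁻ ω in firstSymbol i, g ω ∂P := by
  rw [← lintegral_map hg measurable_shift, hP.map_shift_restrict_firstSymbol,
    lintegral_finsetSum_measure]
  simp [lintegral_smul_measure]

end IsMarkovianFullShift

/-! ### Families of densities that are invariant under the transfer operator -/

/-- Subtraction is truncated, so one of the two differences vanishes and the last bracket is `|x -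
y|²`. The expansion of the square can thus stay in `ℝ≥0∞`. -/
theorem sq_add_sq_eq {x y : ℝ≥0∞} (hx : x ≠ ∞) (hy : y ≠ ∞) :
    x ^ 2 + y ^ 2 = 2 * (x * y) + ((x - y) ^ 2 + (y - x) ^ 2) := by
  wlog h : x ≤ y generalizing x y
  · have := this hy hx (le_of_not_ge h)
    rw [add_comm, this, mul_comm y x, add_comm ((y - x) ^ 2)]
  obtain ⟨z, rfl⟩ := exists_add_of_le h
  rw [ENNReal.add_sub_cancel_left hx, tsub_eq_zero_of_le h]
  ring

/-- A square-summable family of densities fixed by the transfer operator is equivariant. -/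
theorem ae_eq_comp_shift_of_transfer_invariant {S : Type*} {P : Measure (Omega k)}
    (hP : MeasurePreserving shift P P) (T : Fin k → S ≃ S) {f : S → Omega k → ℝ≥0∞}
    (hf : ∀ V, Measurable (f V)) (hf1 : ∀ V ω, f V ω ≤ 1)
    (hsum : ∑' V, ∫⁻ ω, f V ω ∂P ≠ ∞)
    (hinv : ∀ W, P.withDensity (f W) =
      ∑ j, ((P.withDensity (f ((T j).symm W))).restrict (firstSymbol j)).map shift)
    (V : S) (j : Fin k) :
    ∀ᵐ ω ∂P.restrict (firstSymbol j), f V ω = f (T j V) (shift ω) := by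
  have hfs : ∀ V, Measurable fun ω => f V (shift ω) := fun V => (hf V).comp measurable_shift
  set Q := ∑' V, ∫⁻ ω, f V ω ^ 2 ∂P
  -- `f² ≤ f` because `f ≤ 1`.
  have hQtop : Q ≠ ∞ := by
    refine ne_top_of_le_ne_top hsum (ENNReal.tsum_le_tsum fun V => lintegral_mono fun ω => ?_)
    exact pow_le_of_le_one zero_le (hf1 V ω) two_ne_zero
  have hswap : ∀ F : Fin k → S → ℝ≥0∞, ∑ j, ∑' V, F j V = ∑' V, ∑ j, F j V := fun F =>
    (Summable.tsum_finsetSum fun _ _ => ENNReal.summable).symm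
  have h1 : ∑ j, ∑' V, ∫⁻ ω in firstSymbol j, f V ω ^ 2 ∂P = Q := by
    rw [hswap]
    exact tsum_congr fun V => (lintegral_eq_sum_firstSymbol P _).symm
  -- Each `T j` only permutes the index set, and the shift preserves `P`.
  have h2 : ∑ j, ∑' V, ∫⁻ ω in firstSymbol j, f (T j V) (shift ω) ^ 2 ∂P = Q := by
    have e : ∀ j, ∑' V, ∫⁻ ω in firstSymbol j, f (T j V) (shift ω) ^ 2 ∂P =
        ∑' V, ∫⁻ ω in firstSymbol j, f V (shift ω) ^ 2 ∂P := fun j =>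
      (T j).tsum_eq fun V => ∫⁻ ω in firstSymbol j, f V (shift ω) ^ 2 ∂P
    rw [Finset.sum_congr rfl fun j _ => e j, hswap]
    refine tsum_congr fun V => ?_
    rw [← lintegral_eq_sum_firstSymbol P fun ω => f V (shift ω) ^ 2]
    exact hP.lintegral_comp ((hf V).pow_const 2)
  -- With `W = T j V`, the cross terms are the transfer identity for `W` tested against `f W`
  -- itself.
  have h3 : ∑ j, ∑' V, ∫⁻ ω in firstSymbol j, f V ω * f (T j V) (shift ω) ∂P = Q := by
    have e : ∀ j, ∑' V, ∫⁻ ω in firstSymbol j, f V ω * f (T j V) (shift ω) ∂P =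
        ∑' V, ∫⁻ ω in firstSymbol j, f ((T j).symm V) ω * f V (shift ω) ∂P := fun j => by
      refine Eq.trans ?_ ((T j).tsum_eq _)
      exact tsum_congr fun V => by rw [Equiv.symm_apply_apply]
    rw [Finset.sum_congr rfl fun j _ => e j, hswap]
    refine tsum_congr fun W => ?_
    have h := congrArg (fun μ : Measure (Omega k) => ∫⁻ ω, f W ω ∂μ) (hinv W)
    rw [lintegral_withDensity_eq_lintegral_mul _ (hf W) (hf W), lintegral_finsetSum_measure] at h
    simp_rw [pow_two]
    refine Eq.trans ?_ h.symm
    refine Finset.sum_congr rfl fun j _ => ?_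
    rw [lintegral_map (hf W) measurable_shift, restrict_withDensity (measurableSet_firstSymbol j),
      lintegral_withDensity_eq_lintegral_mul _ (hf _) (hfs W)]
    rfl
  set D : Fin k → S → ℝ≥0∞ := fun j V => ∫⁻ ω in firstSymbol j,
    ((f V ω - f (T j V) (shift ω)) ^ 2 + (f (T j V) (shift ω) - f V ω) ^ 2) ∂P
  have htop : ∀ V ω, f V ω ≠ ∞ := fun V ω => ne_top_of_le_ne_top ENNReal.one_ne_top (hf1 V ω)
  have hDm : ∀ j V, Measurable fun ω =>
      ((f V ω - f (T j V) (shift ω)) ^ 2 + (f (T j V) (shift ω) - f V ω) ^ 2) := fun j V =>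
    (((hf V).sub (hfs _)).pow_const 2).add (((hfs _).sub (hf V)).pow_const 2)
  have hpt : ∀ j V, ∫⁻ ω in firstSymbol j, f V ω ^ 2 ∂P +
      ∫⁻ ω in firstSymbol j, f (T j V) (shift ω) ^ 2 ∂P =
      2 * ∫⁻ ω in firstSymbol j, f V ω * f (T j V) (shift ω) ∂P + D j V := by
    intro j V
    have hm : Measurable fun ω => f V ω * f (T j V) (shift ω) := (hf V).mul (hfs _)
    rw [← lintegral_add_left ((hf V).pow_const 2), ← lintegral_const_mul _ hm,
      ← lintegral_add_left (hm.const_mul 2)]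
    exact lintegral_congr fun ω => sq_add_sq_eq (htop _ _) (htop _ _)
  have htot : Q + Q = 2 * Q + ∑ j, ∑' V, D j V := by
    nth_rewrite 1 [← h1]
    nth_rewrite 1 [← h2]
    nth_rewrite 1 [← h3]
    rw [Finset.mul_sum, ← Finset.sum_add_distrib, ← Finset.sum_add_distrib]
    refine Finset.sum_congr rfl fun j _ => ?_
    rw [← ENNReal.tsum_mul_left, ← ENNReal.tsum_add, ← ENNReal.tsum_add]
    exact tsum_congr fun V => hpt j V
  -- Cancelling `2 * Q` requires that `Q` be finite.
  have hzero : ∑ j, ∑' V, D j V = 0 := by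
    rw [← two_mul] at htot
    exact (ENNReal.add_right_inj (ENNReal.mul_ne_top ENNReal.ofNat_ne_top hQtop)).1
      (by rw [← htot, add_zero])
  have hz : D j V = 0 :=
    ENNReal.tsum_eq_zero.1 (Finset.sum_eq_zero_iff.1 hzero j (Finset.mem_univ j)) V
  filter_upwards [(lintegral_eq_zero_iff (hDm j V)).1 hz] with ω hω
  simp only [Pi.zero_apply, add_eq_zero, pow_eq_zero_iff, ne_eq, two_ne_zero, not_false_eq_true,
    tsub_eq_zero_iff_le] at hω
  exact le_antisymm hω.1 hω.2

/-! ### Maximal atoms of a harmonic family -/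

/-- The maximum principle for a nonnegative family, small outside finite sets, that is harmonic
for a chain with positive transition probabilities. -/
theorem exists_finset_mapsTo_of_harmonic {ι S : Type*} [Fintype ι] (T : ι → S → S)
    (q : ι → ι → ℝ) (hq : ∀ j i, 0 < q j i) (hq1 : ∀ j, ∑ i, q j i = 1) (h : ι → S → ℝ)
    (hharm : ∀ j V, h j V = ∑ i, q j i * h i (T j V))
    (hfin : ∀ ε > 0, ∀ j, {V | ε ≤ h j V}.Finite) (hpos : ∃ j V, 0 < h j V) :
    ∃ F : Finset S, F.Nonempty ∧ (∀ V ∈ F, ∀ j, 0 < h j V) ∧ ∀ j, ∀ V ∈ F, T j V ∈ F := by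
  classical
  obtain ⟨j₀, V₀, h₀⟩ := hpos
  have hfinite : {x : ι × S | h j₀ V₀ ≤ h x.1 x.2}.Finite := by
    have : {x : ι × S | h j₀ V₀ ≤ h x.1 x.2} ⊆
        ⋃ j, Prod.mk j '' {V | h j₀ V₀ ≤ h j V} := by
      rintro ⟨j, V⟩ hx
      exact mem_iUnion.2 ⟨j, V, hx, rfl⟩
    exact (finite_iUnion fun j => (hfin _ h₀ j).image _).subset this
  obtain ⟨⟨j₁, V₁⟩, hx, hmax'⟩ := Set.exists_max_image _ (fun x : ι × S => h x.1 x.2) hfinite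
    ⟨(j₀, V₀), le_refl (h j₀ V₀)⟩
  set m := h j₁ V₁ with hm
  have hm0 : 0 < m := h₀.trans_le hx
  have hmax : ∀ j V, h j V ≤ m := fun j V => by
    by_cases hc : h j₀ V₀ ≤ h j V
    · exact hmax' (j, V) hc
    · exact (lt_of_not_ge hc).le.trans hx
  -- The maximum `m` is an average, with positive weights, of values at most `m`; all of them must
  -- equal `m`.
  have hstep : ∀ j V, h j V = m → ∀ i, h i (T j V) = m := by
    intro j V hjV
    have hs : ∑ i, q j i * (m - h i (T j V)) = 0 := by
      simp_rw [mul_sub]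
      rw [Finset.sum_sub_distrib, ← Finset.sum_mul, hq1, ← hharm, hjV]
      ring
    intro i
    have hi := (Finset.sum_eq_zero_iff_of_nonneg fun i _ =>
      mul_nonneg (hq j i).le (sub_nonneg.2 (hmax i (T j V)))).1 hs i (Finset.mem_univ i)
    rcases mul_eq_zero.1 hi with h' | h'
    · exact absurd h' (hq j i).ne'
    · linarith
  have hF : {V | ∀ i, h i V = m}.Finite :=
    (hfin m hm0 j₁).subset fun V hV => (hV j₁).ge
  -- `V₁` is known to be maximal only for the symbol `j₁`; its image is maximal for every symbol.
  refine ⟨hF.toFinset, ⟨T j₁ V₁, ?_⟩, ?_, ?_⟩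
  · simpa using hstep j₁ V₁ rfl
  · intro V hV j
    rw [(by simpa using hV : ∀ i, h i V = m) j]
    exact hm0
  · intro j V hV
    have hV' : ∀ i, h i V = m := by simpa using hV
    simpa using hstep j V (hV' j)

/-- A summable family of measures dominated by a Markovian full shift and jointly invariant under
fibre bijections depending on the first symbol has a finite set of atoms stable under all of
these bijections. -/
theorem IsMarkovianFullShift.exists_finset_mapsTo {S : Type*} {P : Measure (Omega k)}
    (hP : IsMarkovianFullShift P) (T : Fin k → S ≃ S) (n : S → Measure (Omega k))
    (hle : ∀ V, n V ≤ P) (hsum : ∑' V, n V univ ≠ ∞)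
    (hinv : ∀ W, n W = ∑ j, ((n ((T j).symm W)).restrict (firstSymbol j)).map shift)
    (hne : ∃ V, n V ≠ 0) :
    ∃ F : Finset S, F.Nonempty ∧ (∀ V ∈ F, n V ≠ 0) ∧ ∀ j, ∀ V ∈ F, T j V ∈ F := by
  have := hP.isProbabilityMeasure
  have hnfin : ∀ V, IsFiniteMeasure (n V) := fun V => isFiniteMeasure_of_le P (hle V)
  have hdens : ∀ V, ∃ f : Omega k → ℝ≥0∞, Measurable f ∧ (∀ ω, f ω ≤ 1) ∧
      n V = P.withDensity f := by
    intro V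
    -- Truncating at `1` turns the almost everywhere bound into one valid everywhere.
    refine ⟨fun ω => min ((n V).rnDeriv P ω) 1, (Measure.measurable_rnDeriv _ _).min
      measurable_const, fun ω => min_le_right _ _, ?_⟩
    have : (n V).HaveLebesgueDecomposition P :=
      Measure.haveLebesgueDecomposition_of_sigmaFinite _ _
    refine (Measure.withDensity_rnDeriv_eq (n V) P
      (Measure.absolutelyContinuous_of_le (hle V))).symm.trans (withDensity_congr_ae ?_)
    filter_upwards [Measure.rnDeriv_le_one_of_le (hle V)] with ω hω
    exact (min_eq_left hω).symm
  choose f hf hf1 hnf using hdens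
  have hequi := ae_eq_comp_shift_of_transfer_invariant hP.invariant T hf hf1
    (by simpa [hnf] using hsum) (fun W => by rw [← hnf, hinv W]; simp_rw [← hnf])
  have hatom : ∀ j V, n V (firstSymbol j) =
      ∑ i, backwardWeight P j i * n (T j V) (firstSymbol i) := by
    intro j V
    rw [hnf V, withDensity_apply _ (measurableSet_firstSymbol j), lintegral_congr_ae (hequi V j),
      hP.setLIntegral_comp_shift j (hf _)]
    refine Finset.sum_congr rfl fun i _ => ?_
    rw [hnf (T j V), withDensity_apply _ (measurableSet_firstSymbol i)]
  have hp0 : ∀ j, 0 < P.real (firstSymbol j) := fun j =>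
    ENNReal.toReal_pos (hP.firstSymbol_pos j).ne' (measure_ne_top _ _)
  have hweights : ∀ j, P.real (firstSymbol j) =
      ∑ i, (backwardWeight P j i).toReal * P.real (firstSymbol i) := by
    intro j
    have h := hP.setLIntegral_comp_shift j (g := fun _ => 1) measurable_const
    simp only [setLIntegral_one] at h
    rw [measureReal_def, h, ENNReal.toReal_sum fun i _ =>
      ENNReal.mul_ne_top (hP.backwardWeight_ne_top j i) (measure_ne_top _ _)]
    simp [measureReal_def]
  -- Dividing by `P[j]` converts the backward weights into the forward probabilities `P(ω₀ = j, ω₁ =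
  -- i) / P[j]`, whose sum over `i` is `1`.
  have hharm : ∀ j V, (n V).real (firstSymbol j) / P.real (firstSymbol j) =
      ∑ i, (backwardWeight P j i).toReal * P.real (firstSymbol i) / P.real (firstSymbol j) *
        ((n (T j V)).real (firstSymbol i) / P.real (firstSymbol i)) := by
    intro j V
    rw [measureReal_def, hatom, ENNReal.toReal_sum fun i _ =>
      ENNReal.mul_ne_top (hP.backwardWeight_ne_top j i) (measure_ne_top _ _), Finset.sum_div]
    refine Finset.sum_congr rfl fun i _ => ?_
    rw [ENNReal.toReal_mul, ← measureReal_def]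
    have := (hp0 i).ne'
    have := (hp0 j).ne'
    field_simp
  have hfin : ∀ ε > 0, ∀ j,
      {V | ε ≤ (n V).real (firstSymbol j) / P.real (firstSymbol j)}.Finite := by
    intro ε hε j
    refine (ENNReal.finite_const_le_of_tsum_ne_top hsum (ε := ENNReal.ofReal
      (ε * P.real (firstSymbol j))) (by simpa using mul_pos hε (hp0 j))).subset fun V hV => ?_
    have h1 : ε * P.real (firstSymbol j) ≤ (n V).real (firstSymbol j) := (le_div_iff₀ (hp0 j)).1 hV
    exact (ENNReal.ofReal_le_of_le_toReal h1).trans (measure_mono (subset_univ _))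
  have hpos : ∃ j V, 0 < (n V).real (firstSymbol j) / P.real (firstSymbol j) := by
    obtain ⟨V, hV⟩ := hne
    by_contra! hc
    refine hV (Measure.measure_univ_eq_zero.1 ?_)
    rw [← lintegral_one, lintegral_eq_sum_firstSymbol]
    refine Finset.sum_eq_zero fun j _ => ?_
    rw [setLIntegral_one]
    have h1 := (div_le_iff₀ (hp0 j)).1 (hc j V)
    rw [zero_mul] at h1
    exact (measureReal_eq_zero_iff).1 (le_antisymm h1 measureReal_nonneg)
  obtain ⟨F, hF, hFpos, hFT⟩ := exists_finset_mapsTo_of_harmonic (fun j => T j)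
    (fun j i => (backwardWeight P j i).toReal * P.real (firstSymbol i) / P.real (firstSymbol j))
    (fun j i => div_pos (mul_pos (ENNReal.toReal_pos (hP.backwardWeight_pos j i).ne'
      (hP.backwardWeight_ne_top j i)) (hp0 i)) (hp0 j))
    (fun j => by rw [← Finset.sum_div, ← hweights, div_self (hp0 j).ne'])
    (fun j V => (n V).real (firstSymbol j) / P.real (firstSymbol j)) hharm hfin hpos
  refine ⟨F, hF, fun V hV h0 => ?_, hFT⟩
  -- A sequence is needed only to supply some symbol `ω 0`.
  obtain ⟨ω⟩ := nonempty_of_isProbabilityMeasure P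
  simpa [h0] using hFpos V hV (ω 0)

variable {d : ℕ}

/-! ### Projective subspaces -/

theorem map_mem_projSubspace_iff {f : (Fin d → ℝ) →ₗ[ℝ] (Fin d → ℝ)} (hf : Function.Injective f)
    (W : Submodule ℝ (Fin d → ℝ)) (p : Proj d) :
    Projectivization.map f hf p ∈ projSubspace W ↔ p ∈ projSubspace (W.comap f) := by
  induction p using Projectivization.ind with
  | h v hv =>
    change (Projectivization.map f hf (Projectivization.mk ℝ v hv)).submodule ≤ W ↔
      (Projectivization.mk ℝ v hv).submodule ≤ W.comap f
    rw [Projectivization.map_mk, Projectivization.submodule_mk, Projectivization.submodule_mk,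
      Submodule.span_singleton_le_iff_mem, Submodule.span_singleton_le_iff_mem,
      Submodule.mem_comap]

theorem projSubspace_inf (V W : Submodule ℝ (Fin d → ℝ)) :
    projSubspace (V ⊓ W) = projSubspace V ∩ projSubspace W := by
  ext p
  change p.submodule ≤ V ⊓ W ↔ p.submodule ≤ V ∧ p.submodule ≤ W
  exact le_inf_iff

theorem projSubspace_bot : projSubspace (⊥ : Submodule ℝ (Fin d → ℝ)) = ∅ := by
  refine eq_empty_of_forall_notMem fun p hp => ?_
  have h := p.finrank_submodule
  rw [le_bot_iff.1 (show p.submodule ≤ ⊥ from hp), finrank_bot] at h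
  exact zero_ne_one h

theorem measurableSet_projSubspace (V : Submodule ℝ (Fin d → ℝ)) :
    MeasurableSet (projSubspace V) := by
  refine IsClosed.measurableSet ?_
  rw [← (isOpenQuotientMap_projMk d).isQuotientMap.isClosed_preimage]
  have : projMk d ⁻¹' projSubspace V = Subtype.val ⁻¹' (V : Set (Fin d → ℝ)) := by
    ext v
    change (Projectivization.mk ℝ v.1 v.2).submodule ≤ V ↔ v.1 ∈ V
    rw [Projectivization.submodule_mk, Submodule.span_singleton_le_iff_mem]
  rw [this]
  exact V.closed_of_finiteDimensional.preimage continuous_subtype_val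

/-! ### Generators of a linear system depending on the first symbol -/

namespace LRDS

variable (φ : LRDS k d)

/-- The linear automorphism applied upon reading the symbol `j`. -/
noncomputable def generator (h : φ.SpatiallyInvertible) (j : Fin k) :
    (Fin d → ℝ) ≃ₗ[ℝ] (Fin d → ℝ) :=
  LinearEquiv.ofInjectiveEndo (φ.mat 1 fun _ => j).mulVecLin (φ.injective_mat h 1 _)

/-- The permutation of the linear subspaces induced by a generator. -/
noncomputable def subspaceEquiv (h : φ.SpatiallyInvertible) (j : Fin k) :
    Submodule ℝ (Fin d → ℝ) ≃ Submodule ℝ (Fin d → ℝ) :=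
  (Submodule.orderIsoMapComap (φ.generator h j)).toEquiv

variable {φ}

theorem mulVecLin_mat_one (h : φ.SpatiallyInvertible) (hfirst : φ.DependsOnFirst)
    (ω : Omega k) :
    (φ.mat 1 ω).mulVecLin = (φ.generator h (ω 0) : (Fin d → ℝ) →ₗ[ℝ] (Fin d → ℝ)) := by
  rw [hfirst ω (fun _ => ω 0) rfl]
  rfl

theorem subspaceEquiv_apply (h : φ.SpatiallyInvertible) (j : Fin k)
    (V : Submodule ℝ (Fin d → ℝ)) : φ.subspaceEquiv h j V =
      V.map (φ.generator h j : (Fin d → ℝ) →ₗ[ℝ] (Fin d → ℝ)) := rfl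

theorem subspaceEquiv_symm_apply (h : φ.SpatiallyInvertible) (j : Fin k)
    (V : Submodule ℝ (Fin d → ℝ)) : (φ.subspaceEquiv h j).symm V =
      V.comap (φ.generator h j : (Fin d → ℝ) →ₗ[ℝ] (Fin d → ℝ)) := rfl

theorem finrank_subspaceEquiv_symm (h : φ.SpatiallyInvertible) (j : Fin k)
    (V : Submodule ℝ (Fin d → ℝ)) :
    Module.finrank ℝ ((φ.subspaceEquiv h j).symm V) = Module.finrank ℝ V := by
  conv_rhs => rw [← (φ.subspaceEquiv h j).apply_symm_apply V]
  rw [subspaceEquiv_apply, LinearEquiv.finrank_map_eq]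

theorem map_mat_mem (h : φ.SpatiallyInvertible) (hfirst : φ.DependsOnFirst)
    {F : Finset (Submodule ℝ (Fin d → ℝ))}
    (hF : ∀ j, ∀ V ∈ F, φ.subspaceEquiv h j V ∈ F) (n : ℕ) (ω : Omega k)
    {V : Submodule ℝ (Fin d → ℝ)} (hV : V ∈ F) : V.map (φ.mat n ω).mulVecLin ∈ F := by
  induction n with
  | zero => simpa [φ.zero] using hV
  | succ n ih =>
    rw [φ.add, Matrix.mulVecLin_mul, Submodule.map_comp, mulVecLin_mat_one h hfirst]
    exact hF _ _ ih

/-- An injective self-map of a finite family is a permutation, so inclusion under the generators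
upgrades to the equality of unions that strong irreducibility speaks of. -/
theorem not_stronglyIrreducible_of_finset (h : φ.SpatiallyInvertible)
    (hfirst : φ.DependsOnFirst) {F : Finset (Submodule ℝ (Fin d → ℝ))} (hne : F.Nonempty)
    (hproper : ∀ V ∈ F, V ≠ ⊥ ∧ V ≠ ⊤) (hF : ∀ j, ∀ V ∈ F, φ.subspaceEquiv h j V ∈ F) :
    ¬ φ.StronglyIrreducible := by
  classical
  refine fun hirr => hirr ⟨F, hne, hproper, ?_⟩
  rintro _ ⟨n, ω, rfl⟩
  have himage : F.image (Submodule.map (φ.mat n ω).mulVecLin) = F := by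
    refine Finset.eq_of_subset_of_card_le ?_ ?_
    · intro W hW
      obtain ⟨V, hV, rfl⟩ := Finset.mem_image.1 hW
      exact map_mat_mem h hfirst hF n ω hV
    · rw [Finset.card_image_of_injective _
        (Submodule.map_injective_of_injective (φ.injective_mat h n ω))]
  conv_rhs => rw [← himage, Finset.set_biUnion_finset_image]
  rw [image_iUnion₂]
  rfl

/-! ### Fibre measures over projective subspaces -/

theorem measurable_skewProduct (h : φ.SpatiallyInvertible) :
    Measurable (φ.induced h).skewProduct :=
  (measurable_shift.comp measurable_fst).prodMk ((φ.induced h).measurable_toFun.comp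
    (measurable_const.prodMk (measurable_fst.prodMk measurable_snd) :
      Measurable fun p : Omega k × Proj d => (1, p.1, p.2)))

theorem skewProduct_preimage (h : φ.SpatiallyInvertible) (hfirst : φ.DependsOnFirst)
    (B : Set (Omega k)) (W : Submodule ℝ (Fin d → ℝ)) :
    (φ.induced h).skewProduct ⁻¹' (B ×ˢ projSubspace W) =
      ⋃ j, (shift ⁻¹' B ∩ firstSymbol j) ×ˢ projSubspace ((φ.subspaceEquiv h j).symm W) := by
  ext ⟨ω, p⟩
  have key : (φ.induced h).toFun 1 ω p ∈ projSubspace W ↔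
      p ∈ projSubspace ((φ.subspaceEquiv h (ω 0)).symm W) := by
    rw [subspaceEquiv_symm_apply, ← mulVecLin_mat_one h hfirst]
    exact map_mem_projSubspace_iff (φ.injective_mat h 1 ω) _ _
  simp only [mem_iUnion, mem_prod, mem_inter_iff]
  constructor
  · rintro ⟨h1, h2⟩
    exact ⟨ω 0, ⟨h1, rfl⟩, key.1 h2⟩
  · rintro ⟨j, ⟨h1, rfl⟩, h2⟩
    exact ⟨h1, key.2 h2⟩

end LRDS

/-- The measure `B ↦ ν (B × ℙ V)`. -/
noncomputable def fiberMeasure (ν : Measure (Omega k × Proj d))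
    (V : Submodule ℝ (Fin d → ℝ)) : Measure (Omega k) :=
  (ν.restrict (univ ×ˢ projSubspace V)).map Prod.fst

theorem fiberMeasure_apply (ν : Measure (Omega k × Proj d)) (V : Submodule ℝ (Fin d → ℝ))
    {B : Set (Omega k)} (hB : MeasurableSet B) :
    fiberMeasure ν V B = ν (B ×ˢ projSubspace V) := by
  rw [fiberMeasure, Measure.map_apply measurable_fst hB,
    Measure.restrict_apply (measurable_fst hB)]
  congr 1
  ext x
  simp

/-- Invariance of `ν` on `B × ℙW`, with the preimage split by first symbol: on `[j]` the points sent
into `ℙW` are those of `ℙ(T_j⁻¹ W)`. -/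
theorem fiberMeasure_eq_sum {φ : LRDS k d} (h : φ.SpatiallyInvertible)
    (hfirst : φ.DependsOnFirst) {ν : Measure (Omega k × Proj d)}
    (hν : ν.map (φ.induced h).skewProduct = ν) (W : Submodule ℝ (Fin d → ℝ)) :
    fiberMeasure ν W = ∑ j, ((fiberMeasure ν ((φ.subspaceEquiv h j).symm W)).restrict
      (firstSymbol j)).map shift := by
  ext B hB
  have hd : Pairwise (Function.onFun Disjoint fun j => (shift ⁻¹' B ∩ firstSymbol j) ×ˢ
      projSubspace ((φ.subspaceEquiv h j).symm W)) := by
    intro i j hij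
    exact Set.disjoint_left.2 fun x h1 h2 => hij (Eq.trans (Eq.symm h1.1.2) h2.1.2)
  have hm : ∀ j, MeasurableSet (shift ⁻¹' B ∩ firstSymbol j) := fun j =>
    (measurable_shift hB).inter (measurableSet_firstSymbol j)
  rw [fiberMeasure_apply ν W hB]
  conv_lhs => rw [← hν]
  rw [Measure.map_apply (LRDS.measurable_skewProduct h) (hB.prod (measurableSet_projSubspace W)),
    LRDS.skewProduct_preimage h hfirst,
    measure_iUnion hd fun j => (hm j).prod (measurableSet_projSubspace _), tsum_fintype,
    Measure.finsetSum_apply]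
  refine Finset.sum_congr rfl fun j _ => ?_
  rw [Measure.map_apply measurable_shift hB, Measure.restrict_apply (measurable_shift hB),
    fiberMeasure_apply _ _ (hm j)]

/-- If all subspaces of dimension less than `l` are null, the subspaces of dimension `l` have
summable masses. -/
theorem tsum_fiberMeasure_univ_le (ν : Measure (Omega k × Proj d)) {l : ℕ}
    (hl : ∀ V : Submodule ℝ (Fin d → ℝ), Module.finrank ℝ V < l →
      ν (univ ×ˢ projSubspace V) = 0) :
    ∑' V : Submodule ℝ (Fin d → ℝ),
      (if Module.finrank ℝ V = l then fiberMeasure ν V else 0) univ ≤ ν univ := by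
  have hle := tsum_measure_le_measure_univ (μ := ν)
    (s := fun V : Submodule ℝ (Fin d → ℝ) =>
      if Module.finrank ℝ V = l then univ ×ˢ projSubspace V else ∅) ?_ ?_
  · refine le_trans (ENNReal.tsum_le_tsum fun V => ?_) hle
    split_ifs
    · exact (fiberMeasure_apply ν V MeasurableSet.univ).le
    · simp
  · intro V
    split_ifs
    · exact (MeasurableSet.univ.prod (measurableSet_projSubspace V)).nullMeasurableSet
    · exact MeasurableSet.empty.nullMeasurableSet
  · intro V W hVW
    change ν ((if _ then _ else _) ∩ (if _ then _ else _)) = 0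
    split_ifs with hV hW
    -- Distinct subspaces of equal dimension have an intersection of smaller dimension, which is
    -- null by `hl`.
    · rw [← prod_inter, ← projSubspace_inf]
      refine hl _ ?_
      rw [← hV]
      refine Submodule.finrank_lt_finrank_of_lt (inf_le_left.lt_of_ne fun h => hVW ?_)
      exact Submodule.eq_of_le_of_finrank_eq (inf_eq_left.1 h) (hV.trans hW.symm)
    all_goals simp

end MarkovRDS

/-! ### Charged subspaces of minimal dimension -/

open MarkovRDS

theorem mainTheorem5 {k d : ℕ} (P : MeasureTheory.Measure (MarkovRDS.Omega k))
    (hP : MarkovRDS.IsMarkovianFullShift P)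
    (φ : MarkovRDS.LRDS k d) (hirr : φ.StronglyIrreducible) (hinv : φ.SpatiallyInvertible)
    (hfirst : φ.DependsOnFirst)
    (ν : MeasureTheory.Measure (MarkovRDS.Omega k × MarkovRDS.Proj d))
    (hν : (φ.induced hinv).IsInvariantMeasure P ν) :
    MarkovRDS.IsProper ν := by
  classical
  have := hν.isProbabilityMeasure
  intro H hH
  by_contra hH0
  have hex : ∃ l, ∃ V : Submodule ℝ (Fin d → ℝ), Module.finrank ℝ V = l ∧
      ν (univ ×ˢ projSubspace V) ≠ 0 := ⟨_, H, rfl, hH0⟩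
  set l := Nat.find hex with hl
  obtain ⟨V₀, hV₀, hV₀ν⟩ := Nat.find_spec hex
  have hmin : ∀ V : Submodule ℝ (Fin d → ℝ), Module.finrank ℝ V < l →
      ν (univ ×ˢ projSubspace V) = 0 := fun V hV => by
    by_contra h0
    exact Nat.find_min hex hV ⟨V, rfl, h0⟩
  have hld : l < d := by
    have : l ≤ Module.finrank ℝ H := Nat.find_min' hex ⟨H, rfl, hH0⟩
    lia
  have hl0 : l ≠ 0 := by
    intro h0
    rw [← hl, h0, Submodule.finrank_eq_zero] at hV₀
    rw [hV₀, projSubspace_bot] at hV₀ν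
    simp at hV₀ν
  obtain ⟨F, hFne, hF, hFT⟩ := hP.exists_finset_mapsTo (φ.subspaceEquiv hinv)
    -- Zero in the other dimensions: the generators permute all subspaces, but only those of
    -- dimension `l` have summable masses. As generators preserve dimension, the transfer identity
    -- survives.
    (fun V => if Module.finrank ℝ V = l then fiberMeasure ν V else 0)
    (fun V => by
      split_ifs
      · rw [← hν.map_fst]
        exact Measure.map_mono Measure.restrict_le_self measurable_fst
      · exact Measure.zero_le P)
    (ne_top_of_le_ne_top (measure_ne_top ν univ) (tsum_fiberMeasure_univ_le ν hmin))
    (fun W => by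
      simp only [LRDS.finrank_subspaceEquiv_symm]
      split_ifs
      · exact fiberMeasure_eq_sum hinv hfirst hν.map_skewProduct W
      · simp)
    ⟨V₀, fun h0 => hV₀ν (by
      rw [if_pos hV₀] at h0
      rw [← fiberMeasure_apply ν V₀ MeasurableSet.univ, h0]
      rfl)⟩
  refine LRDS.not_stronglyIrreducible_of_finset hinv hfirst hFne (fun V hV => ?_) hFT hirr
  have hVl : Module.finrank ℝ V = l := by
    by_contra hne
    exact hF V hV (if_neg hne)
  constructor
  · rintro rfl
    exact hl0 (by rw [← hVl, finrank_bot])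
  · rintro rfl
    rw [finrank_top, Module.finrank_fin_fun] at hVl
    exact hld.ne' hVl
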